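/- Let $\mathbb K$ be a field. A (multiplicative) Hom-Leibniz algebra $(L,\alpha_L)$ is a $\mathbb K$-vector space $L$ with a bilinear bracket $[-,-]$ and a linear map $\alpha_L:L\to L$ such that $\alpha_L[x,y]=[\alpha_L(x),\alpha_L(y)]$ and $[\alpha_L(x),[y,z]]=[[x,y],\alpha_L(z)]-[[x,z],\alpha_L(y)]$ for all $x,y,z\in L$. It is perfect if $L=[L,L]$ (the span of all brackets). A two-sided Hom-ideal is a subspace $M\subseteq L$ with $\alpha_L(M)\subseteq M$ and $[x,y],[y,x]\in M$ for $x\in M$, $y\in L$; write $\alpha_M=\alpha_L|_M$, let $[L,M]$ be the span of all $[l,m]$, $[m,l]$ with $l\in L$, $m\in M$, and give $L/M$ the induced Hom-Leibniz structure. The second homology with trivial coefficients is $HL_2^\alpha(L)=\ker d_2/\operatorname{im} d_3$, where $d_2:L^{\otimes 2}\to L$, $d_2(x\otimes y)=-[x,y]$, and $d_3:L^{\otimes 3}\to L^{\otimes 2}$, $d_3(x\otimes y\otimes z)=-[x,y]\otimes\alpha_L(z)+[x,z]\otimes\alpha_L(y)+\alpha_L(x)\otimes[y,z]$. Let $M$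 be a two-sided Hom-ideal of $L$. The Hom-Leibniz algebras $L$ and $M$ act on each other by the bracket of $L$: ${}^{l}m=[l,m]$, $m^{l}=[m,l]$, ${}^{m}l=[m,l]$, $l^{m}=[l,m]$. The underlying vector space of the non-abelian Hom-Leibniz tensor product $L\ast M$ is the quotient of $(L\otimes M)\oplus(M\otimes L)$, whose elementary tensors are written $l\ast m$ and $m\ast l$ respectively (two separate kinds of symbols), by the relations, for all $l,l'\in L$ and $m,m'\in M$, $$\begin{aligned} \alpha_L(l)\ast[m,m']&=l^{m}\ast\alpha_M(m')-l^{m'}\ast\alpha_M(m), & \alpha_M(m)\ast[l,l']&=m^{l}\ast\alpha_L(l')-m^{l'}\ast\alpha_L(l),\\ [l,l']\ast\alpha_M(m)&={}^{l}m\ast\alpha_L(l')-\alpha_L(l)\ast m^{l'}, & [m,m']\ast\alpha_L(l)&={}^{m}l\ast\alpha_M(m')-\alpha_M(m)\ast l^{m'},\\ \alpha_L(l)\ast{}^{l'}m&=-\alpha_L(l)\ast m^{l'}, & \alpha_M(m)\ast{}^{m'}l&=-\alpha_M(m)\ast l^{m'},\\ l^{m}\ast{}^{l'}m'&={}^{l}m\ast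 l'^{\,m'}, & l^{m}\ast m'^{\,l'}&={}^{l}m\ast{}^{m'}l',\\ {}^{m}l\ast{}^{l'}m'&=m^{l}\ast l'^{\,m'}, & {}^{m}l\ast m'^{\,l'}&=m^{l}\ast{}^{m'}l', \end{aligned}$$ where in each term ${}^{l}m$ and $m^{l}$ are regarded as elements of $M$ and ${}^{m}l$ and $l^{m}$ as elements of $L$, and every bracket $[l,l']$ is in $L$ and $[m,m']$ in $M$. Let $\psi_2:L\ast M\to L$ be the linear map with $\psi_2(l\ast m)=[l,m]$, $\psi_2(m\ast l)=[m,l]$. **Theorem.** Let $(M,\alpha_M)$ be a two-sided Hom-ideal of a perfect Hom-Leibniz algebra $(L,\alpha_L)$. Then there is an exact sequence of vector spaces $$\operatorname{Ker}(L\ast M\xrightarrow{\psi_2}L)\xrightarrow{\,f\,}HL_2^\alpha(L)\xrightarrow{\,g\,}HL_2^\alpha(L/M)\xrightarrow{\,\delta\,}M/[L,M]\to 0 .$$ Here $f$ is induced by $l\ast m\mapsto l\otimes m$ and $m\ast l\mapsto m\otimes l$; $g$ is induced by the projection $L\to L/M$; and $\delta$ sends the class of a cycle $\sum_i\overline{x_i}\otimes\overline{y_i}$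 (with $x_i,y_i\in L$) to the class of $\sum_i[x_i,y_i]\in M$. -/

import Mathlib

open scoped TensorProduct

/-- A (multiplicative) Hom-Leibniz algebra structure on the `K`-vector space `L`. -/
structure HomLeibniz (K : Type*) (L : Type*) [Field K] [AddCommGroup L] [Module K L] where
  /-- the bracket `[x, y]` -/
  br : L →ₗ[K] L →ₗ[K] L
  /-- the twisting endomorphism -/
  α : L →ₗ[K] L
  hom_leibniz : ∀ x y z, br (α x) (br y z) = br (br x y) (α z) - br (br x z) (α y)
  α_br : ∀ x y, α (br x y) = br (α x) (α y)

/-- A Hom-Leibniz action of `(L, A)` on `(M, B)`: `left x m` is `ˣm` and `right m x` is `mˣ`. -/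
structure HomAction {K L M : Type*} [Field K] [AddCommGroup L] [Module K L]
    [AddCommGroup M] [Module K M] (A : HomLeibniz K L) (B : HomLeibniz K M) where
  left : L →ₗ[K] M →ₗ[K] M
  right : M →ₗ[K] L →ₗ[K] M
  right_br : ∀ x y m,
    right (B.α m) (A.br x y) = right (right m x) (A.α y) - right (right m y) (A.α x)
  br_left : ∀ x y m,
    left (A.br x y) (B.α m) = right (left x m) (A.α y) - left (A.α x) (right m y)
  left_left : ∀ x y m, left (A.α x) (left y m) = - left (A.α x) (right m y)
  left_br : ∀ x m m',
    left (A.α x) (B.br m m') = B.br (left x m) (B.α m') - B.br (left x m') (B.α m)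
  br_right : ∀ x m m',
    right (B.br m m') (A.α x) = B.br (right m x) (B.α m') + B.br (B.α m) (right m' x)
  br_left_eq : ∀ x m m', B.br (B.α m) (left x m') = - B.br (B.α m) (right m' x)
  α_left : ∀ x m, B.α (left x m) = left (A.α x) (B.α m)
  α_right : ∀ x m, B.α (right m x) = right (B.α m) (A.α x)

/-- Compatible Hom-Leibniz actions of `(M, A)` and `(N, B)` on each other. -/
structure CompatibleActions {K M N : Type*} [Field K] [AddCommGroup M] [Module K M]
    [AddCommGroup N] [Module K N] (A : HomLeibniz K M) (B : HomLeibniz K N) where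
  /-- the action of `M` on `N`: `onN.left m n` is `ᵐn`, `onN.right n m` is `nᵐ` -/
  onN : HomAction A B
  /-- the action of `N` on `M`: `onM.left n m` is `ⁿm`, `onM.right m n` is `mⁿ` -/
  onM : HomAction B A
  c1 : ∀ m m' n, onM.left (onN.left m n) m' = A.br (onM.right m n) m'
  c2 : ∀ n n' m, onN.left (onM.left n m) n' = B.br (onN.right n m) n'
  c3 : ∀ m m' n, onM.left (onN.right n m) m' = A.br (onM.left n m) m'
  c4 : ∀ n n' m, onN.left (onM.right m n) n' = B.br (onN.left m n) n'
  c5 : ∀ m m' n, onM.right m (onN.left m' n) = A.br m (onM.right m' n)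
  c6 : ∀ n n' m, onN.right n (onM.left n' m) = B.br n (onN.right n' m)
  c7 : ∀ m m' n, onM.right m (onN.right n m') = A.br m (onM.left n m')
  c8 : ∀ n n' m, onN.right n (onM.right m n') = B.br n (onN.left m n')

namespace CompatibleActions

variable {K M N : Type*} [Field K] [AddCommGroup M] [Module K M]
  [AddCommGroup N] [Module K N] {A : HomLeibniz K M} {B : HomLeibniz K N}

/-- The symbol `m ∗ n` before the non-bilinear relations are imposed. -/
def mn (K : Type*) {M N : Type*} [Field K] [AddCommGroup M] [Module K M]
    [AddCommGroup N] [Module K N] (m : M) (n : N) : (M ⊗[K] N) × (N ⊗[K] M) :=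
  (m ⊗ₜ[K] n, 0)

/-- The symbol `n ∗ m` before the non-bilinear relations are imposed. -/
def nm (K : Type*) {M N : Type*} [Field K] [AddCommGroup M] [Module K M]
    [AddCommGroup N] [Module K N] (n : N) (m : M) : (M ⊗[K] N) × (N ⊗[K] M) :=
  (0, n ⊗ₜ[K] m)

/-- The defining relations of `M ∗ N`, other than bilinearity of the two kinds of symbols. -/
inductive Rel (S : CompatibleActions A B) :
    (M ⊗[K] N) × (N ⊗[K] M) → (M ⊗[K] N) × (N ⊗[K] M) → Prop
  | r1 (m : M) (n n' : N) : Rel S (mn K (A.α m) (B.br n n'))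
      (mn K (S.onM.right m n) (B.α n') - mn K (S.onM.right m n') (B.α n))
  | r2 (n : N) (m m' : M) : Rel S (nm K (B.α n) (A.br m m'))
      (nm K (S.onN.right n m) (A.α m') - nm K (S.onN.right n m') (A.α m))
  | r3 (m m' : M) (n : N) : Rel S (mn K (A.br m m') (B.α n))
      (nm K (S.onN.left m n) (A.α m') - mn K (A.α m) (S.onN.right n m'))
  | r4 (n n' : N) (m : M) : Rel S (nm K (B.br n n') (A.α m))
      (mn K (S.onM.left n m) (B.α n') - nm K (B.α n) (S.onM.right m n'))
  | r5 (m m' : M) (n : N) : Rel S (mn K (A.α m) (S.onN.left m' n))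
      (- mn K (A.α m) (S.onN.right n m'))
  | r6 (n n' : N) (m : M) : Rel S (nm K (B.α n) (S.onM.left n' m))
      (- nm K (B.α n) (S.onM.right m n'))
  | r7 (m m' : M) (n n' : N) : Rel S (mn K (S.onM.right m n) (S.onN.left m' n'))
      (nm K (S.onN.left m n) (S.onM.right m' n'))
  | r8 (m m' : M) (n n' : N) : Rel S (mn K (S.onM.right m n) (S.onN.right n' m'))
      (nm K (S.onN.left m n) (S.onM.left n' m'))
  | r9 (m m' : M) (n n' : N) : Rel S (mn K (S.onM.left n m) (S.onN.left m' n'))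
      (nm K (S.onN.right n m) (S.onM.right m' n'))
  | r10 (m m' : M) (n n' : N) : Rel S (mn K (S.onM.left n m) (S.onN.right n' m'))
      (nm K (S.onN.right n m) (S.onM.left n' m'))

/-- The subspace of `(M ⊗ N) ⊕ (N ⊗ M)` spanned by the defining relations. -/
def relSpan (S : CompatibleActions A B) : Submodule K ((M ⊗[K] N) × (N ⊗[K] M)) :=
  Submodule.span K {z | ∃ p q, Rel S p q ∧ z = p - q}

/-- The underlying vector space of the non-abelian Hom-Leibniz tensor product `M ∗ N`. The
summands `M ⊗ N` and `N ⊗ M` carry the symbols `m ∗ n` and `n ∗ m` respectively. -/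
abbrev Tensor (S : CompatibleActions A B) : Type _ :=
  ((M ⊗[K] N) × (N ⊗[K] M)) ⧸ S.relSpan

/-- `m ∗ n ↦ ᵐn` and `n ∗ m ↦ nᵐ` on `(M ⊗ N) ⊕ (N ⊗ M)`. -/
noncomputable def prePsi₂ (S : CompatibleActions A B) : (M ⊗[K] N) × (N ⊗[K] M) →ₗ[K] N :=
  (TensorProduct.lift S.onN.left).coprod (TensorProduct.lift S.onN.right)

theorem relSpan_le (S : CompatibleActions A B) : S.relSpan ≤ LinearMap.ker S.prePsi₂ := by
  refine Submodule.span_le.2 ?_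
  rintro _ ⟨p, q, h, rfl⟩
  rw [SetLike.mem_coe, LinearMap.mem_ker, map_sub, sub_eq_zero]
  cases h with
  | r1 m n n' => simp [prePsi₂, mn, S.c4, S.onN.left_br]
  | r2 n m m' => simp [prePsi₂, nm, S.onN.right_br]
  | r3 m m' n => simp [prePsi₂, mn, nm, S.onN.br_left, sub_eq_add_neg, add_comm]
  | r4 n n' m =>
    simp [prePsi₂, mn, nm, S.onN.br_right, S.c2, S.c8, S.onN.br_left_eq]
  | r5 m m' n => simp [prePsi₂, mn, S.onN.left_left]
  | r6 n n' m => simp [prePsi₂, nm, S.c6, S.c8, S.onN.br_left_eq]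
  | r7 m m' n n' => simp [prePsi₂, mn, nm, S.c4, S.c8]
  | r8 m m' n n' => simp [prePsi₂, mn, nm, S.c4, S.c6]
  | r9 m m' n n' => simp [prePsi₂, mn, nm, S.c2, S.c8]
  | r10 m m' n n' => simp [prePsi₂, mn, nm, S.c2, S.c6]

/-- The map `ψ₂ : M ∗ N → N`, `ψ₂ (m ∗ n) = ᵐn`, `ψ₂ (n ∗ m) = nᵐ`. -/
noncomputable def psi₂ (S : CompatibleActions A B) : S.Tensor →ₗ[K] N :=
  S.relSpan.liftQ S.prePsi₂ S.relSpan_le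

end CompatibleActions

namespace HomLeibniz

variable {K L : Type*} [Field K] [AddCommGroup L] [Module K L]

/-- The subspace spanned by all `[h, k]` and `[k, h]` with `h ∈ H`, `k ∈ P`; for two-sided
Hom-ideals this is their commutator. -/
def commutator (A : HomLeibniz K L) (H P : Submodule K L) : Submodule K L :=
  Submodule.span K {z | ∃ h ∈ H, ∃ k ∈ P, z = A.br h k ∨ z = A.br k h}

/-- `L = [L, L]`. -/
def IsPerfect (A : HomLeibniz K L) : Prop :=
  A.commutator ⊤ ⊤ = ⊤

/-- A two-sided Hom-ideal. -/
structure HomIdeal (A : HomLeibniz K L) extends Submodule K L where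
  α_mem : ∀ {x}, x ∈ carrier → A.α x ∈ carrier
  br_mem_left : ∀ {x} (y), x ∈ carrier → A.br x y ∈ carrier
  br_mem_right : ∀ (y) {x}, x ∈ carrier → A.br y x ∈ carrier

section Homology

variable (A : HomLeibniz K L)

/-- The linear map `L ⊗ L → L`, `x ⊗ y ↦ [x, y]`. -/
noncomputable def brTensor : L ⊗[K] L →ₗ[K] L :=
  TensorProduct.lift A.br

/-- The boundary `d₂ : L ⊗ L → L`, `x₁ ⊗ x₂ ↦ -[x₁, x₂]`, of the complex with trivial
coefficients `K ⊗ L^{⊗n} = L^{⊗n}`. -/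
noncomputable def d₂ : L ⊗[K] L →ₗ[K] L :=
  - A.brTensor

/-- The boundary `d₃ : L ⊗ L ⊗ L → L ⊗ L`,
`x₁ ⊗ x₂ ⊗ x₃ ↦ -[x₁, x₂] ⊗ α x₃ + [x₁, x₃] ⊗ α x₂ + α x₁ ⊗ [x₂, x₃]`,
of the complex with trivial coefficients. -/
noncomputable def d₃ : (L ⊗[K] L) ⊗[K] L →ₗ[K] L ⊗[K] L :=
  - TensorProduct.map A.brTensor A.α
  + TensorProduct.map A.brTensor A.α ∘ₗ (TensorProduct.rightComm K L L L).toLinearMap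
  + TensorProduct.map A.α A.brTensor ∘ₗ (TensorProduct.assoc K L L L).toLinearMap

theorem d₃_tmul (x y z : L) : A.d₃ ((x ⊗ₜ[K] y) ⊗ₜ[K] z) =
    - (A.br x y ⊗ₜ[K] A.α z) + A.br x z ⊗ₜ[K] A.α y + A.α x ⊗ₜ[K] A.br y z := by
  simp [d₃, brTensor]

theorem d₂_comp_d₃ : A.d₂ ∘ₗ A.d₃ = 0 := by
  ext x y z
  simp [d₃_tmul, d₂, brTensor, A.hom_leibniz]

/-- The second homology `HL₂^α(L) = ker d₂ / im d₃` with trivial coefficients. -/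
abbrev HL₂ : Type _ :=
  LinearMap.ker A.d₂ ⧸ (LinearMap.range A.d₃).submoduleOf (LinearMap.ker A.d₂)

/-- The homology class of a `2`-cycle. -/
noncomputable def HL₂.mk {A : HomLeibniz K L} (t : L ⊗[K] L) (ht : A.d₂ t = 0) : A.HL₂ :=
  Submodule.Quotient.mk ⟨t, ht⟩

end Homology

namespace HomIdeal

variable {A : HomLeibniz K L} (I : A.HomIdeal)

/-- The Hom-Leibniz algebra structure of a two-sided Hom-ideal. -/
def toHomLeibniz : HomLeibniz K I.toSubmodule where
  br := LinearMap.mk₂ K (fun x y => ⟨A.br x y, I.br_mem_left _ x.2⟩)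
    (fun _ _ _ => Subtype.ext (by simp)) (fun _ _ _ => Subtype.ext (by simp))
    (fun _ _ _ => Subtype.ext (by simp)) (fun _ _ _ => Subtype.ext (by simp))
  α := A.α.restrict fun _ hx => I.α_mem hx
  hom_leibniz x y z := Subtype.ext (A.hom_leibniz x y z)
  α_br x y := Subtype.ext (A.α_br x y)

/-- The Hom-Leibniz algebra `L / I`. -/
def quotient : HomLeibniz K (L ⧸ I.toSubmodule) where
  br := I.toSubmodule.liftQ
    (LinearMap.mk₂ K
      (fun x => I.toSubmodule.mapQ I.toSubmodule (A.br x) fun _ hy => I.br_mem_right x hy)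
      (fun x x' y => by induction y using Submodule.Quotient.induction_on; simp)
      (fun c x y => by induction y using Submodule.Quotient.induction_on; simp)
      (fun x y y' => by simp)
      (fun c x y => by simp))
    (fun x hx => by
      refine LinearMap.ext fun y => ?_
      induction y using Submodule.Quotient.induction_on with
      | _ y => exact (Submodule.Quotient.mk_eq_zero _).2 (I.br_mem_left y hx))
  α := I.toSubmodule.mapQ I.toSubmodule A.α fun _ hx => I.α_mem hx
  hom_leibniz x y z := by
    induction x using Submodule.Quotient.induction_on with | _ x
    induction y using Submodule.Quotient.induction_on with | _ y
    induction z using Submodule.Quotient.induction_on with | _ z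
    exact congrArg (Submodule.Quotient.mk (p := I.toSubmodule)) (A.hom_leibniz x y z)
  α_br x y := by
    induction x using Submodule.Quotient.induction_on with | _ x
    induction y using Submodule.Quotient.induction_on with | _ y
    exact congrArg (Submodule.Quotient.mk (p := I.toSubmodule)) (A.α_br x y)

theorem quotient_br_mk (x y : L) :
    I.quotient.br (I.toSubmodule.mkQ x) (I.toSubmodule.mkQ y) =
      I.toSubmodule.mkQ (A.br x y) := rfl

theorem quotient_α_mk (x : L) :
    I.quotient.α (I.toSubmodule.mkQ x) = I.toSubmodule.mkQ (A.α x) := rfl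

/-- The action of `L` on its ideal `I` by the bracket of `L`. -/
def actOnIdeal : HomAction A I.toHomLeibniz where
  left := LinearMap.mk₂ K (fun x m => ⟨A.br x m, I.br_mem_right _ m.2⟩)
    (fun _ _ _ => Subtype.ext (by simp)) (fun _ _ _ => Subtype.ext (by simp))
    (fun _ _ _ => Subtype.ext (by simp)) (fun _ _ _ => Subtype.ext (by simp))
  right := LinearMap.mk₂ K (fun m x => ⟨A.br m x, I.br_mem_left _ m.2⟩)
    (fun _ _ _ => Subtype.ext (by simp)) (fun _ _ _ => Subtype.ext (by simp))
    (fun _ _ _ => Subtype.ext (by simp)) (fun _ _ _ => Subtype.ext (by simp))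
  right_br x y m := Subtype.ext (A.hom_leibniz m x y)
  br_left x y m := Subtype.ext (by
    change A.br (A.br x y) (A.α m) = A.br (A.br x m) (A.α y) - A.br (A.α x) (A.br m y)
    rw [A.hom_leibniz]; abel)
  left_left x y m := Subtype.ext (by
    change A.br (A.α x) (A.br y m) = - A.br (A.α x) (A.br m y)
    rw [A.hom_leibniz, A.hom_leibniz]; abel)
  left_br x m m' := Subtype.ext (A.hom_leibniz x m m')
  br_right x m m' := Subtype.ext (by
    change A.br (A.br m m') (A.α x) = A.br (A.br m x) (A.α m') + A.br (A.α m) (A.br m' x)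
    rw [A.hom_leibniz]; abel)
  br_left_eq x m m' := Subtype.ext (by
    change A.br (A.α m) (A.br x m') = - A.br (A.α m) (A.br m' x)
    rw [A.hom_leibniz, A.hom_leibniz]; abel)
  α_left x m := Subtype.ext (A.α_br x m)
  α_right x m := Subtype.ext (A.α_br m x)

/-- The action of the ideal `I` on `L` by the bracket of `L`. -/
def idealAct : HomAction I.toHomLeibniz A where
  left := A.br ∘ₗ I.toSubmodule.subtype
  right := A.br.compl₂ I.toSubmodule.subtype
  right_br x y m := A.hom_leibniz m x y
  br_left x y m := by
    change A.br (A.br x y) (A.α m) = A.br (A.br x m) (A.α y) - A.br (A.α x) (A.br m y)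
    rw [A.hom_leibniz]; abel
  left_left x y m := by
    change A.br (A.α x) (A.br y m) = - A.br (A.α x) (A.br m y)
    rw [A.hom_leibniz, A.hom_leibniz]; abel
  left_br x m m' := A.hom_leibniz x m m'
  br_right x m m' := by
    change A.br (A.br m m') (A.α x) = A.br (A.br m x) (A.α m') + A.br (A.α m) (A.br m' x)
    rw [A.hom_leibniz]; abel
  br_left_eq x m m' := by
    change A.br (A.α m) (A.br x m') = - A.br (A.α m) (A.br m' x)
    rw [A.hom_leibniz, A.hom_leibniz]; abel
  α_left x m := A.α_br x m
  α_right x m := A.α_br m x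

/-- The compatible actions of `L` and its ideal `I` on each other by the bracket of `L`; the
tensor product of these actions is `L ∗ I`. -/
def actions : CompatibleActions A I.toHomLeibniz where
  onN := I.actOnIdeal
  onM := I.idealAct
  c1 _ _ _ := rfl
  c2 _ _ _ := rfl
  c3 _ _ _ := rfl
  c4 _ _ _ := rfl
  c5 _ _ _ := rfl
  c6 _ _ _ := rfl
  c7 _ _ _ := rfl
  c8 _ _ _ := rfl

/-- The map `ψ₂ : L ∗ I → L`, `l ∗ m ↦ [l, m]`, `m ∗ l ↦ [m, l]`. -/
noncomputable def psi : I.actions.Tensor →ₗ[K] L :=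
  I.toSubmodule.subtype ∘ₗ I.actions.psi₂

/-- The quotient space `I / [L, I]`. -/
abbrev ModCommutator : Type _ :=
  I.toSubmodule ⧸ (A.commutator ⊤ I.toSubmodule).submoduleOf I.toSubmodule

/-- The linear map `(L ⊗ I) ⊕ (I ⊗ L) → L ⊗ L` given on each summand by the inclusion `I ⊆ L`. -/
noncomputable def inclTensor :
    (L ⊗[K] I.toSubmodule) × (I.toSubmodule ⊗[K] L) →ₗ[K] L ⊗[K] L :=
  (TensorProduct.map LinearMap.id I.toSubmodule.subtype).coprod
    (TensorProduct.map I.toSubmodule.subtype LinearMap.id)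

/-- The linear map `L ⊗ L → L/I ⊗ L/I` induced by the projection `L → L/I`. -/
noncomputable def projTensor :
    L ⊗[K] L →ₗ[K] (L ⧸ I.toSubmodule) ⊗[K] (L ⧸ I.toSubmodule) :=
  TensorProduct.map I.toSubmodule.mkQ I.toSubmodule.mkQ

end HomIdeal

end HomLeibniz

/-! Everything is lifted to `L ⊗ L`. By right exactness of the tensor product, the kernel of `L ⊗ L
→ L/M ⊗ L/M` is the image of `(L ⊗ M) ⊕ (M ⊗ L)` (`ker_projTensor`), and every boundary of `L/M`
lifts to a boundary of `L` (`mem_range_quotient_d₃_iff`). So a tensor over `L` projects to a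
boundary exactly when it is a boundary of `L` plus some `inclTensor u`.

The bracket of `inclTensor u` is `ψ₂` of the class of `u` (`psi_mk`), and these brackets fill `[L,
M]` (`range_brTensor_comp_inclTensor`). Hence if the tensor is a cycle, `u` gives an element of `Ker
ψ₂`: exactness at `HL₂(L)`. For a lift of a cycle of `L/M`, the bracket lies in `M` and is well
defined modulo `[L, M]`; when it lies in `[L, M]`, subtracting a suitable `inclTensor u` makes the
lift a cycle: exactness at `HL₂(L/M)`. Perfectness makes every element of `M` the bracket of a
tensor, so `δ` is onto. The map `f` exists because the relations of `L ∗ M` become boundaries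
(`inclTensor_mem_range_d₃`). -/

theorem LinearMap.exists_factor_of_surjective {K U V W : Type*} [Field K] [AddCommGroup U]
    [Module K U] [AddCommGroup V] [Module K V] [AddCommGroup W] [Module K W]
    (q : V →ₗ[K] W) (hq : Function.Surjective q) (φ : V →ₗ[K] U)
    (h : ∀ v, q v = 0 → φ v = 0) : ∃ f : W →ₗ[K] U, ∀ v, f (q v) = φ v := by
  refine ⟨(LinearMap.ker q).liftQ φ (fun v hv => h v hv) ∘ₗ
    (q.quotKerEquivOfSurjective hq).symm.toLinearMap, fun v => ?_⟩
  have : (q.quotKerEquivOfSurjective hq).symm (q v) = Submodule.Quotient.mk v := by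
    rw [LinearEquiv.symm_apply_eq]
    rfl
  rw [LinearMap.comp_apply, LinearEquiv.coe_coe, this]
  rfl

namespace HomLeibniz

variable {K L : Type*} [Field K] [AddCommGroup L] [Module K L] {A : HomLeibniz K L}

theorem d₂_apply (t : L ⊗[K] L) : A.d₂ t = -A.brTensor t := rfl

theorem d₂_eq_zero_iff {t : L ⊗[K] L} : A.d₂ t = 0 ↔ A.brTensor t = 0 := by
  rw [d₂_apply, neg_eq_zero]

theorem d₂_d₃ (s : (L ⊗[K] L) ⊗[K] L) : A.d₂ (A.d₃ s) = 0 :=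
  LinearMap.congr_fun A.d₂_comp_d₃ s

theorem brTensor_d₃ (s : (L ⊗[K] L) ⊗[K] L) : A.brTensor (A.d₃ s) = 0 :=
  d₂_eq_zero_iff.1 (d₂_d₃ s)

namespace HL₂

theorem mk_eq_mk_iff {t t' : L ⊗[K] L} (ht : A.d₂ t = 0) (ht' : A.d₂ t' = 0) :
    mk t ht = mk t' ht' ↔ t - t' ∈ LinearMap.range A.d₃ :=
  Submodule.Quotient.eq _

theorem mk_eq_zero_iff {t : L ⊗[K] L} (ht : A.d₂ t = 0) :
    mk t ht = 0 ↔ t ∈ LinearMap.range A.d₃ :=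
  Submodule.Quotient.mk_eq_zero _

theorem exists_mk (c : A.HL₂) : ∃ t, ∃ ht : A.d₂ t = 0, mk t ht = c := by
  obtain ⟨⟨t, ht⟩, rfl⟩ := Submodule.Quotient.mk_surjective _ c
  exact ⟨t, ht, rfl⟩

end HL₂

theorem IsPerfect.brTensor_surjective (hA : A.IsPerfect) : Function.Surjective A.brTensor := by
  rw [← LinearMap.range_eq_top, eq_top_iff, ← hA]
  refine Submodule.span_le.2 ?_
  rintro _ ⟨x, -, y, -, rfl | rfl⟩
  · exact ⟨x ⊗ₜ y, rfl⟩
  · exact ⟨y ⊗ₜ x, rfl⟩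

namespace HomIdeal

variable (M : A.HomIdeal)

/-! ### Cycles and boundaries of the quotient, lifted to `L ⊗ L`. -/

theorem quotient_brTensor_projTensor (t : L ⊗[K] L) :
    M.quotient.brTensor (M.projTensor t) = M.toSubmodule.mkQ (A.brTensor t) := by
  induction t with
  | zero => simp
  | tmul x y => rfl
  | add s t hs ht => simp only [map_add, hs, ht]

theorem quotient_d₂_projTensor_eq_zero_iff {t : L ⊗[K] L} :
    M.quotient.d₂ (M.projTensor t) = 0 ↔ A.brTensor t ∈ M.toSubmodule := by
  rw [d₂_eq_zero_iff, quotient_brTensor_projTensor, Submodule.mkQ_apply,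
    Submodule.Quotient.mk_eq_zero]

theorem projTensor_surjective : Function.Surjective M.projTensor :=
  TensorProduct.map_surjective (Submodule.mkQ_surjective _) (Submodule.mkQ_surjective _)

theorem projTensor_d₃ (s : (L ⊗[K] L) ⊗[K] L) :
    M.projTensor (A.d₃ s) =
      M.quotient.d₃ (TensorProduct.map M.projTensor M.toSubmodule.mkQ s) := by
  refine LinearMap.congr_fun (f := M.projTensor ∘ₗ A.d₃)
    (g := M.quotient.d₃ ∘ₗ TensorProduct.map M.projTensor M.toSubmodule.mkQ) ?_ s
  ext x y z
  simp only [TensorProduct.AlgebraTensorModule.curry_apply, TensorProduct.curry_apply,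
    LinearMap.coe_restrictScalars, LinearMap.comp_apply, TensorProduct.map_tmul,
    projTensor, d₃_tmul, map_add, map_neg, quotient_br_mk, quotient_α_mk]

/-- The projection commutes with `d₃` and is surjective on triple tensors, so a preimage under the
quotient's `d₃` can itself be lifted. -/
theorem mem_range_quotient_d₃_iff {t : L ⊗[K] L} :
    M.projTensor t ∈ LinearMap.range M.quotient.d₃ ↔
      ∃ s, M.projTensor t = M.projTensor (A.d₃ s) := by
  constructor
  · rintro ⟨s, hs⟩
    obtain ⟨s, rfl⟩ := TensorProduct.map_surjective M.projTensor_surjective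
      M.toSubmodule.mkQ_surjective s
    exact ⟨s, by rw [projTensor_d₃, hs]⟩
  · rintro ⟨s, hs⟩
    exact ⟨_, by rw [hs, projTensor_d₃]⟩

theorem ker_projTensor : LinearMap.ker M.projTensor = LinearMap.range M.inclTensor := by
  have hex : Function.Exact M.toSubmodule.subtype M.toSubmodule.mkQ :=
    LinearMap.exact_subtype_mkQ _
  rw [projTensor, TensorProduct.map_ker hex (Submodule.mkQ_surjective _) hex
    (Submodule.mkQ_surjective _), inclTensor, LinearMap.range_coprod]
  rfl

theorem projTensor_inclTensor (u : (L ⊗[K] M.toSubmodule) × (M.toSubmodule ⊗[K] L)) :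
    M.projTensor (M.inclTensor u) = 0 := by
  rw [← LinearMap.mem_ker, ker_projTensor]
  exact ⟨u, rfl⟩

theorem exists_sub_eq_inclTensor {s t : L ⊗[K] L} (h : M.projTensor s = M.projTensor t) :
    ∃ u, M.inclTensor u = s - t := by
  have : s - t ∈ LinearMap.ker M.projTensor := by
    rw [LinearMap.mem_ker, map_sub, h, sub_self]
  rwa [ker_projTensor] at this

/-! ### Comparison of `L ∗ M` with `L ⊗ L`. -/

theorem psi_mk (u : (L ⊗[K] M.toSubmodule) × (M.toSubmodule ⊗[K] L)) :
    M.psi (Submodule.Quotient.mk u) = A.brTensor (M.inclTensor u) := by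
  refine LinearMap.congr_fun (f := M.psi ∘ₗ M.actions.relSpan.mkQ)
    (g := A.brTensor ∘ₗ M.inclTensor) ?_ u
  apply LinearMap.prod_ext <;> ext <;>
    simp [psi, CompatibleActions.psi₂, CompatibleActions.prePsi₂, inclTensor, brTensor] <;> rfl

/-- Two lifts of a tensor over `L/M` differ by some `inclTensor u`, so this range is the ambiguity
in the value of `δ`. -/
theorem range_brTensor_comp_inclTensor :
    LinearMap.range (A.brTensor ∘ₗ M.inclTensor) = A.commutator ⊤ M.toSubmodule := by
  apply le_antisymm
  · rintro _ ⟨⟨a, b⟩, rfl⟩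
    rw [LinearMap.comp_apply, inclTensor, LinearMap.coprod_apply, map_add]
    refine add_mem ?_ ?_
    · induction a with
      | zero => simp
      | tmul x m => exact Submodule.subset_span ⟨x, trivial, m, m.2, Or.inl rfl⟩
      | add a a' ha ha' => simpa only [map_add] using add_mem ha ha'
    · induction b with
      | zero => simp
      | tmul m x => exact Submodule.subset_span ⟨x, trivial, m, m.2, Or.inr rfl⟩
      | add b b' hb hb' => simpa only [map_add] using add_mem hb hb'
  · refine Submodule.span_le.2 ?_
    rintro _ ⟨x, -, m, hm, rfl | rfl⟩
    · exact ⟨(x ⊗ₜ ⟨m, hm⟩, 0), by simp [inclTensor, brTensor]⟩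
    · exact ⟨(0, ⟨m, hm⟩ ⊗ₜ x), by simp [inclTensor, brTensor]⟩

theorem inclTensor_mn (x : L) (m : M.toSubmodule) :
    M.inclTensor (CompatibleActions.mn K x m) = x ⊗ₜ (m : L) := by
  simp [inclTensor, CompatibleActions.mn]

theorem inclTensor_nm (x : L) (m : M.toSubmodule) :
    M.inclTensor (CompatibleActions.nm K m x) = (m : L) ⊗ₜ x := by
  simp [inclTensor, CompatibleActions.nm]

/-- Relations `r1`–`r4` are `d₃` of one elementary tensor with entries from `L` and `M` in different
positions; `r5` and `r6` are sums of two such boundaries; `r7`–`r10` become trivial. -/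
theorem inclTensor_mem_range_d₃ {u : (L ⊗[K] M.toSubmodule) × (M.toSubmodule ⊗[K] L)}
    (hu : u ∈ M.actions.relSpan) : M.inclTensor u ∈ LinearMap.range A.d₃ := by
  suffices h : M.actions.relSpan ≤ (LinearMap.range A.d₃).comap M.inclTensor from h hu
  refine Submodule.span_le.2 ?_
  -- Symmetrizing in the last two entries cancels the first two terms of `d₃`.
  have hswap : ∀ x y z : L, A.α x ⊗ₜ[K] A.br y z + A.α x ⊗ₜ[K] A.br z y =
      A.d₃ ((x ⊗ₜ y) ⊗ₜ z + (x ⊗ₜ z) ⊗ₜ y) := fun x y z => by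
    rw [map_add, d₃_tmul, d₃_tmul]
    abel
  rintro _ ⟨p, q, h, rfl⟩
  rw [SetLike.mem_coe, Submodule.mem_comap, map_sub]
  cases h with
  | r1 l m m' =>
    refine ⟨(l ⊗ₜ m) ⊗ₜ m', ?_⟩
    simp only [map_sub, inclTensor_mn, d₃_tmul]
    change _ = A.α l ⊗ₜ[K] A.br m m' - (A.br l m ⊗ₜ[K] A.α m' - A.br l m' ⊗ₜ[K] A.α m)
    abel
  | r2 m l l' =>
    refine ⟨((m : L) ⊗ₜ l) ⊗ₜ l', ?_⟩
    simp only [map_sub, inclTensor_nm, d₃_tmul]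
    change _ = A.α m ⊗ₜ[K] A.br l l' - (A.br m l ⊗ₜ[K] A.α l' - A.br m l' ⊗ₜ[K] A.α l)
    abel
  | r3 l l' m =>
    refine ⟨(l ⊗ₜ m) ⊗ₜ l', ?_⟩
    simp only [map_sub, inclTensor_mn, inclTensor_nm, d₃_tmul]
    change _ = A.br l l' ⊗ₜ[K] A.α m - (A.br l m ⊗ₜ[K] A.α l' - A.α l ⊗ₜ[K] A.br m l')
    abel
  | r4 m m' l =>
    refine ⟨((m : L) ⊗ₜ l) ⊗ₜ m', ?_⟩
    simp only [map_sub, inclTensor_mn, inclTensor_nm, d₃_tmul]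
    change _ = A.br m m' ⊗ₜ[K] A.α l - (A.br m l ⊗ₜ[K] A.α m' - A.α m ⊗ₜ[K] A.br l m')
    abel
  | r5 l l' m =>
    rw [map_neg, sub_neg_eq_add, inclTensor_mn, inclTensor_mn]
    exact ⟨_, (hswap l l' m).symm⟩
  | r6 m m' l =>
    rw [map_neg, sub_neg_eq_add, inclTensor_nm, inclTensor_nm]
    exact ⟨_, (hswap m m' l).symm⟩
  -- Both actions are the bracket of `L`, so the two sides are definitionally the same tensor of
  -- brackets.
  | r7 | r8 | r9 | r10 =>
    rw [inclTensor_mn, inclTensor_nm]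
    exact (sub_self (_ : L ⊗[K] L)).symm ▸ zero_mem _

/-! ### Construction of the three maps. -/

theorem exists_tensorToHL₂ : ∃ f : LinearMap.ker M.psi →ₗ[K] A.HL₂,
    ∀ (u : (L ⊗[K] M.toSubmodule) × (M.toSubmodule ⊗[K] L))
      (hu : M.psi (Submodule.Quotient.mk u) = 0), ∃ h : A.d₂ (M.inclTensor u) = 0,
      f ⟨Submodule.Quotient.mk u, hu⟩ = HL₂.mk (M.inclTensor u) h := by
  have hcyc : ∀ u, M.psi (Submodule.Quotient.mk u) = 0 → A.d₂ (M.inclTensor u) = 0 :=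
    fun u hu => d₂_eq_zero_iff.2 (by rwa [← psi_mk])
  obtain ⟨f, hf⟩ := LinearMap.exists_factor_of_surjective
    (V := (LinearMap.ker M.psi).comap M.actions.relSpan.mkQ)
    (M.actions.relSpan.mkQ.restrict (q := LinearMap.ker M.psi) fun _ hu => hu)
    (by
      rintro ⟨x, hx⟩
      obtain ⟨u, rfl⟩ := Submodule.Quotient.mk_surjective _ x
      exact ⟨⟨u, hx⟩, rfl⟩)
    (Submodule.mkQ _ ∘ₗ M.inclTensor.restrict (q := LinearMap.ker A.d₂) hcyc)
    (by
      rintro ⟨u, hu⟩ h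
      exact (HL₂.mk_eq_zero_iff (hcyc u hu)).2 (M.inclTensor_mem_range_d₃
        ((Submodule.Quotient.mk_eq_zero _).1 (congrArg Subtype.val h))))
  exact ⟨f, fun u hu => ⟨hcyc u hu, hf ⟨u, hu⟩⟩⟩

theorem exists_HL₂Map : ∃ g : A.HL₂ →ₗ[K] M.quotient.HL₂,
    ∀ (t : L ⊗[K] L) (ht : A.d₂ t = 0), ∃ h : M.quotient.d₂ (M.projTensor t) = 0,
      g (HL₂.mk t ht) = HL₂.mk (M.projTensor t) h := by
  have hcyc : ∀ t, A.d₂ t = 0 → M.quotient.d₂ (M.projTensor t) = 0 := fun t ht => by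
    rw [quotient_d₂_projTensor_eq_zero_iff, d₂_eq_zero_iff.1 ht]
    exact zero_mem _
  refine ⟨Submodule.mapQ _ _ (M.projTensor.restrict (p := LinearMap.ker A.d₂)
    (q := LinearMap.ker M.quotient.d₂) hcyc) ?_, fun t ht => ⟨hcyc t ht, rfl⟩⟩
  rintro ⟨_, ht⟩ ⟨s, rfl⟩
  exact M.mem_range_quotient_d₃_iff.2 ⟨s, rfl⟩

theorem exists_connectingMap : ∃ δ : M.quotient.HL₂ →ₗ[K] M.ModCommutator,
    ∀ (t : L ⊗[K] L) (ht : M.quotient.d₂ (M.projTensor t) = 0),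
      ∃ h : A.brTensor t ∈ M.toSubmodule,
        δ (HL₂.mk (M.projTensor t) ht) = Submodule.Quotient.mk ⟨A.brTensor t, h⟩ := by
  have hmem : ∀ t, M.quotient.d₂ (M.projTensor t) = 0 → A.brTensor t ∈ M.toSubmodule :=
    fun t ht => M.quotient_d₂_projTensor_eq_zero_iff.1 ht
  -- The bracket is taken on all tensors over `L` that project to cycles, then descended to
  -- homology; no choice of lifts is needed.
  obtain ⟨δ, hδ⟩ := LinearMap.exists_factor_of_surjective
    (V := (LinearMap.ker M.quotient.d₂).comap M.projTensor)
    (W := M.quotient.HL₂) (U := M.ModCommutator)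
    (Submodule.mkQ _ ∘ₗ M.projTensor.restrict (q := LinearMap.ker M.quotient.d₂) fun _ ht => ht)
    (fun c => by
      obtain ⟨t, ht, rfl⟩ := HL₂.exists_mk c
      obtain ⟨t, rfl⟩ := M.projTensor_surjective t
      exact ⟨⟨t, ht⟩, rfl⟩)
    (Submodule.mkQ _ ∘ₗ A.brTensor.restrict (q := M.toSubmodule) hmem)
    (by
      rintro ⟨t, ht⟩ h
      -- Here `t = d₃ s + inclTensor u`, and the bracket kills `d₃ s`.
      obtain ⟨s, hs⟩ := M.mem_range_quotient_d₃_iff.1 ((HL₂.mk_eq_zero_iff ht).1 h)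
      obtain ⟨u, hu⟩ := M.exists_sub_eq_inclTensor hs
      refine (Submodule.Quotient.mk_eq_zero _).2 ?_
      change A.brTensor t ∈ A.commutator ⊤ M.toSubmodule
      rw [← range_brTensor_comp_inclTensor]
      exact ⟨u, by rw [LinearMap.comp_apply, hu, map_sub, brTensor_d₃, sub_zero]⟩)
  exact ⟨δ, fun t ht => ⟨hmem t ht, hδ ⟨t, ht⟩⟩⟩

end HomIdeal

end HomLeibniz

/-! ### Exactness. -/

theorem theorem4p6 {K L : Type*} [Field K] [AddCommGroup L] [Module K L]
    (A : HomLeibniz K L) (hA : A.IsPerfect) (M : A.HomIdeal) :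
    ∃ (f : LinearMap.ker M.psi →ₗ[K] A.HL₂)
      (g : A.HL₂ →ₗ[K] M.quotient.HL₂)
      (δ : M.quotient.HL₂ →ₗ[K] M.ModCommutator),
      -- `f` is induced by `l ∗ m ↦ l ⊗ m` and `m ∗ l ↦ m ⊗ l`
      (∀ (u : (L ⊗[K] M.toSubmodule) × (M.toSubmodule ⊗[K] L))
        (hu : M.psi (Submodule.Quotient.mk u) = 0),
        ∃ h : A.d₂ (M.inclTensor u) = 0,
          f ⟨Submodule.Quotient.mk u, hu⟩ = HomLeibniz.HL₂.mk (M.inclTensor u) h) ∧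
      -- `g` is induced by the projection `L → L / M`
      (∀ (t : L ⊗[K] L) (ht : A.d₂ t = 0),
        ∃ h : M.quotient.d₂ (M.projTensor t) = 0,
          g (HomLeibniz.HL₂.mk t ht) = HomLeibniz.HL₂.mk (M.projTensor t) h) ∧
      -- `δ` is the connecting map: lift a cycle to `L ⊗ L`, then apply the bracket of `L`
      (∀ (t : L ⊗[K] L) (ht : M.quotient.d₂ (M.projTensor t) = 0),
        ∃ h : A.brTensor t ∈ M.toSubmodule,
          δ (HomLeibniz.HL₂.mk (M.projTensor t) ht) =
            Submodule.Quotient.mk ⟨A.brTensor t, h⟩) ∧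
      -- exactness
      Function.Exact f g ∧ Function.Exact g δ ∧ Function.Surjective δ := by
  obtain ⟨f, hf⟩ := M.exists_tensorToHL₂
  obtain ⟨g, hg⟩ := M.exists_HL₂Map
  obtain ⟨δ, hδ⟩ := M.exists_connectingMap
  refine ⟨f, g, δ, hf, hg, hδ, fun c => ⟨fun hc => ?_, ?_⟩, fun c => ⟨fun hc => ?_, ?_⟩,
    fun c => ?_⟩
  · obtain ⟨t, ht, rfl⟩ := HomLeibniz.HL₂.exists_mk c
    obtain ⟨h, hgt⟩ := hg t ht
    rw [hgt, HomLeibniz.HL₂.mk_eq_zero_iff, HomLeibniz.HomIdeal.mem_range_quotient_d₃_iff] at hc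
    obtain ⟨s, hs⟩ := hc
    obtain ⟨u, hu⟩ := M.exists_sub_eq_inclTensor hs
    -- Since `inclTensor u = t - d₃ s` is a difference of cycles, `u` defines an element of `Ker
    -- ψ₂`, and its image is homologous to `t`.
    have hpsi : M.psi (Submodule.Quotient.mk u) = 0 := by
      rw [HomLeibniz.HomIdeal.psi_mk, hu, map_sub, HomLeibniz.brTensor_d₃,
        HomLeibniz.d₂_eq_zero_iff.1 ht, sub_zero]
    obtain ⟨h', hfu⟩ := hf u hpsi
    refine ⟨⟨_, hpsi⟩, ?_⟩
    rw [hfu, HomLeibniz.HL₂.mk_eq_mk_iff]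
    exact ⟨-s, by rw [hu, map_neg]; abel⟩
  · rintro ⟨⟨x, hx⟩, rfl⟩
    obtain ⟨u, rfl⟩ := Submodule.Quotient.mk_surjective _ x
    obtain ⟨h, hfu⟩ := hf u hx
    obtain ⟨h', hgu⟩ := hg _ h
    rw [hfu, hgu, HomLeibniz.HL₂.mk_eq_zero_iff, HomLeibniz.HomIdeal.projTensor_inclTensor]
    exact zero_mem _
  · obtain ⟨t, ht, rfl⟩ := HomLeibniz.HL₂.exists_mk c
    obtain ⟨t, rfl⟩ := M.projTensor_surjective t
    obtain ⟨h, hδt⟩ := hδ t ht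
    rw [hδt, Submodule.Quotient.mk_eq_zero] at hc
    replace hc : A.brTensor t ∈ A.commutator ⊤ M.toSubmodule := hc
    rw [← HomLeibniz.HomIdeal.range_brTensor_comp_inclTensor] at hc
    obtain ⟨u, hu⟩ := hc
    -- The corrected lift is a cycle over `L` with the same projection as `t`.
    have hcyc : A.d₂ (t - M.inclTensor u) = 0 := by
      rw [HomLeibniz.d₂_eq_zero_iff, map_sub, ← hu, LinearMap.comp_apply, sub_self]
    obtain ⟨h', hgt⟩ := hg _ hcyc
    refine ⟨HomLeibniz.HL₂.mk _ hcyc, ?_⟩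
    rw [hgt, HomLeibniz.HL₂.mk_eq_mk_iff, map_sub,
      HomLeibniz.HomIdeal.projTensor_inclTensor, sub_zero, sub_self]
    exact zero_mem _
  · rintro ⟨c, rfl⟩
    obtain ⟨t, ht, rfl⟩ := HomLeibniz.HL₂.exists_mk c
    obtain ⟨h, hgt⟩ := hg t ht
    obtain ⟨h', hδt⟩ := hδ t h
    rw [hgt, hδt, Submodule.Quotient.mk_eq_zero]
    change A.brTensor t ∈ A.commutator ⊤ M.toSubmodule
    rw [HomLeibniz.d₂_eq_zero_iff.1 ht]
    exact zero_mem _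
  · obtain ⟨⟨m, hm⟩, rfl⟩ := Submodule.Quotient.mk_surjective _ c
    -- As its bracket `m` lies in `M`, the tensor `t` projects to a cycle of `L/M`.
    obtain ⟨t, rfl⟩ := hA.brTensor_surjective m
    have ht := M.quotient_d₂_projTensor_eq_zero_iff.2 hm
    exact ⟨HomLeibniz.HL₂.mk _ ht, (hδ t ht).2⟩
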